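/- Let $d\ge 1$, let $D\subset\mathbb{R}^d$ be a bounded open set (in particular, $D$ may be a bounded convex Lipschitz polyhedron with $d\in\{1,2,3\}$), and let $H^1_0(D)$ be the closure of $C_c^\infty(D)$ in $H^1(D)$. Let $\kappa\in H^{-1}(D)=H^1_0(D)'$, with $\|\kappa\|_{H^{-1}}=\sup\{|\langle\kappa,w\rangle| : w\in H^1_0(D),\ \|\nabla w\|_{L_2(D)}\le 1\}$. Let $a_0,\psi_1,\psi_2,\ldots\in L_\infty(D)$ and put $a(\mathbf{x},\mathbf{y})=a_0(\mathbf{x})+\sum_{j\ge1}y_j\psi_j(\mathbf{x})$ for $\mathbf{y}\in U:=[-\tfrac12,\tfrac12]^{\mathbb{N}}$. Assume that there are constants $0<a_{\min}\le a_{\max}<\infty$ such that for every $\mathbf{y}\in U$ the series converges absolutely and $a_{\min}\le a(\mathbf{x},\mathbf{y})\le a_{\max}$ for almost every $\mathbf{x}\in D$. Put $b_j=\|\psi_j\|_{L_\infty(D)}/a_{\min}$, and for a multi-index $\boldsymbol\nu$ (finitely supported, with entries in $\{0,1,2,\ldots\}$) put $|\boldsymbol\nu|=\sum_j\nu_j$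 and $\mathbf{b}^{\boldsymbol\nu}=\prod_j b_j^{\nu_j}$. (i) For every $\mathbf{y}\in U$ there is a unique $u(\cdot,\mathbf{y})\in H^1_0(D)$ with $$\int_D a(\mathbf{x},\mathbf{y})\,\nabla u(\mathbf{x},\mathbf{y})\cdot\nabla w(\mathbf{x})\,d\mathbf{x}=\langle\kappa,w\rangle\qquad\text{for all } w\in H^1_0(D).$$ The map $\mathbf{y}\mapsto u(\cdot,\mathbf{y})\in H^1_0(D)$ has mixed partial derivatives $\partial^{\boldsymbol\nu}u$ of all orders on $U$ (as an $H^1_0(D)$-valued map, one-sided where $y_j=\pm\tfrac12$, independent of the order of differentiation), and for every multi-index $\boldsymbol\nu$ and every $\mathbf{y}\in U$ $$\|\nabla\partial^{\boldsymbol\nu}u(\cdot,\mathbf{y})\|_{L_2(D)}\le|\boldsymbol\nu|!\,\mathbf{b}^{\boldsymbol\nu}\,\frac{\|\kappa\|_{H^{-1}}}{a_{\min}}.$$ (ii) Let $s\ge 0$ be an integer and let $V_h\subset H^1_0(D)$ be any finite-dimensional subspace (a conforming finite element space). For every $\mathbf{y}\in[-\tfrac12,\tfrac12]^s$ there is a unique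 $u^s_h(\cdot,\mathbf{y})\in V_h$ such that $$\int_D \Big(a_0(\mathbf{x})+\sum_{j=1}^s y_j\psi_j(\mathbf{x})\Big)\nabla u^s_h(\mathbf{x},\mathbf{y})\cdot\nabla w(\mathbf{x})\,d\mathbf{x}=\langle\kappa,w\rangle\qquad\text{for all } w\in V_h,$$ its mixed partial derivatives of all orders exist on $[-\tfrac12,\tfrac12]^s$ in the same sense, and for every $\boldsymbol\nu\in\{0,1,2,\ldots\}^s$ and every $\mathbf{y}\in[-\tfrac12,\tfrac12]^s$ $$\|\nabla\partial^{\boldsymbol\nu}u^s_h(\cdot,\mathbf{y})\|_{L_2(D)}\le|\boldsymbol\nu|!\,\mathbf{b}^{\boldsymbol\nu}\,\frac{\|\kappa\|_{H^{-1}}}{a_{\min}}.$$ -/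

import Mathlib

open MeasureTheory
open scoped ContDiff

namespace ParamPDE

/-- Euclidean space `ℝ^d`. -/
abbrev E (d : ℕ) : Type := EuclideanSpace ℝ (Fin d)

/-- Pairs `(w, g)` with `w ∈ L₂(D)` and `g ∈ L₂(D; ℝ^d)`, with the Hilbert norm
`(‖w‖² + ‖g‖²)^(1/2)`. A Sobolev function `w` is represented by the pair `(w, ∇w)`, and on such
pairs this is the usual `H¹(D)` norm. -/
abbrev L2Pair {d : ℕ} (D : Set (E d)) : Type :=
  WithLp 2 (Lp ℝ 2 (volume.restrict D) × Lp (E d) 2 (volume.restrict D))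

/-- The pairs `(φ, ∇φ)` with `φ ∈ C_c^∞(D)`. -/
def testPairs {d : ℕ} (D : Set (E d)) : Submodule ℝ (L2Pair D) where
  carrier := {p | ∃ φ : E d → ℝ, ContDiff ℝ ∞ φ ∧ HasCompactSupport φ ∧ tsupport φ ⊆ D ∧
    p.fst =ᵐ[volume.restrict D] φ ∧ p.snd =ᵐ[volume.restrict D] gradient φ}
  zero_mem' := by
    refine ⟨0, contDiff_const, HasCompactSupport.zero, by simp, ?_, ?_⟩
    · exact Lp.coeFn_zero ℝ 2 (volume.restrict D)
    · refine (Lp.coeFn_zero (E d) 2 (volume.restrict D)).trans (Filter.Eventually.of_forall ?_)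
      intro x
      simp [gradient]
  add_mem' := by
    rintro p q ⟨φ, h1, h2, h3, h4, h5⟩ ⟨χ, k1, k2, k3, k4, k5⟩
    refine ⟨φ + χ, h1.add k1, h2.add k2,
      (tsupport_add φ χ).trans (Set.union_subset h3 k3), ?_, ?_⟩
    · exact (Lp.coeFn_add p.fst q.fst).trans (h4.add k4)
    · refine (Lp.coeFn_add p.snd q.snd).trans ((h5.add k5).trans (Filter.Eventually.of_forall ?_))
      intro x
      have hx := (h1.differentiable (by simp)).differentiableAt (x := x)
      have kx := (k1.differentiable (by simp)).differentiableAt (x := x)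
      simp [gradient, fderiv_add hx kx]
  smul_mem' := by
    rintro c p ⟨φ, h1, h2, h3, h4, h5⟩
    refine ⟨c • φ, contDiff_const.smul h1, h2.smul_left (f := fun _ => c),
      (tsupport_smul_subset_right (fun _ => c) φ).trans h3, ?_, ?_⟩
    · exact (Lp.coeFn_smul c p.fst).trans (h4.const_smul c)
    · refine (Lp.coeFn_smul c p.snd).trans
        ((h5.const_smul c).trans (Filter.Eventually.of_forall ?_))
      intro x
      have hx := (h1.differentiable (by simp)).differentiableAt (x := x)
      simp [gradient, fderiv_const_smul hx c]

/-- The Sobolev space `H¹₀(D)`: the closure of `C_c^∞(D)` in the `H¹` norm. -/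
noncomputable def H10 {d : ℕ} (D : Set (E d)) : Submodule ℝ (L2Pair D) :=
  (testPairs D).topologicalClosure

/-- The weak gradient `∇w ∈ L₂(D; ℝ^d)` of `w ∈ H¹₀(D)`. Its norm `‖grad w‖` is
`‖∇w‖_{L₂} = ‖w‖_{H¹₀}`. -/
noncomputable def grad {d : ℕ} {D : Set (E d)} (w : H10 D) : Lp (E d) 2 (volume.restrict D) :=
  (w : L2Pair D).snd

/-- The norm of `κ ∈ H⁻¹(D)`, dual to `‖w‖_{H¹₀} = ‖∇w‖_{L₂}`. -/
noncomputable def dualNorm {d : ℕ} {D : Set (E d)} (κ : H10 D →L[ℝ] ℝ) : ℝ :=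
  sSup {r : ℝ | ∃ w : H10 D, ‖grad w‖ ≤ 1 ∧ r = |κ w|}

/-- `u ∈ V` and `∫_D a ∇u · ∇w dx = ⟨κ, w⟩` for all `w ∈ V`, where `V` is a subspace
of `H¹₀(D)` and `κ ∈ H⁻¹(D)` (for `κ ∈ L₂(D)` the pairing `⟨κ, w⟩` is `∫_D κ w dx`). -/
def IsVariationalSolution {d : ℕ} {D : Set (E d)} (V : Submodule ℝ (H10 D))
    (a : E d → ℝ) (κ : H10 D →L[ℝ] ℝ) (u : H10 D) : Prop :=
  u ∈ V ∧ ∀ w ∈ V, ∫ x in D, a x * inner ℝ (grad u x) (grad w x) = κ w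

/-- `u ∈ H¹₀(D)` is the weak solution of `-∇ · (a ∇u) = κ` in `D`, `u = 0` on `∂D`. -/
abbrev IsWeakSolution {d : ℕ} {D : Set (E d)} (a : E d → ℝ) (κ : H10 D →L[ℝ] ℝ)
    (u : H10 D) : Prop :=
  IsVariationalSolution ⊤ a κ u

/-- The parameter domain `[-1/2, 1/2]^ι`. -/
def paramBox (ι : Type*) : Set (ι → ℝ) :=
  {y | ∀ j, y j ∈ Set.Icc (-1 / 2 : ℝ) (1 / 2)}

/-- The affine coefficient `a(x, y) = a₀(x) + ∑ⱼ yⱼ ψⱼ(x)`. -/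
noncomputable def coeff {d : ℕ} {ι : Type*} (a₀ : E d → ℝ) (ψ : ι → E d → ℝ)
    (y : ι → ℝ) (x : E d) : ℝ :=
  a₀ x + ∑' j, y j * ψ j x

/-- `v ν = ∂^ν u` on `[-1/2, 1/2]^ι` for all multi-indices `ν`: `v 0 = u`, and each `v ν` is
differentiable in each variable `yⱼ` (one-sidedly at `yⱼ = ±1/2`) with derivative `v (ν + eⱼ)`.
In particular the order of differentiation does not matter. -/
def IsMixedDerivatives {ι : Type*} [DecidableEq ι] {X : Type*} [NormedAddCommGroup X]
    [NormedSpace ℝ X] (u : (ι → ℝ) → X) (v : (ι →₀ ℕ) → (ι → ℝ) → X) : Prop :=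
  (∀ y ∈ paramBox ι, v 0 y = u y) ∧
  ∀ (ν : ι →₀ ℕ) (j : ι), ∀ y ∈ paramBox ι,
    HasDerivWithinAt (fun t => v ν (Function.update y j t)) (v (ν + Finsupp.single j 1) y)
      (Set.Icc (-1 / 2 : ℝ) (1 / 2)) (y j)

/-- `bⱼ = ‖ψⱼ‖_{L_∞(D)} / a_min`. -/
noncomputable def bSeq {d : ℕ} {ι : Type*} (D : Set (E d)) (ψ : ι → E d → ℝ) (amin : ℝ)
    (j : ι) : ℝ :=
  (eLpNorm (ψ j) ⊤ (volume.restrict D)).toReal / amin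

/-- `|ν|! b^ν`, where `|ν| = ∑ⱼ νⱼ` and `b^ν = ∏ⱼ bⱼ^νⱼ`. -/
noncomputable def factorialPow {ι : Type*} (b : ι → ℝ) (ν : ι →₀ ℕ) : ℝ :=
  ((ν.sum fun _ n => n).factorial : ℝ) * ν.prod fun j n => b j ^ n

end ParamPDE

open ParamPDE

/-! By Poincaré, `‖∇w‖` controls the `H¹` norm on `H¹₀(D)`, so the gradient maps a complete subspace
`V` isomorphically onto a closed subspace `W` of `L₂(D; ℝ^d)`. There the variational problem reads
`A(y) g = f`, where `A(y)` is multiplication by `a(·, y)` compressed to `W` and `f` is the Riesz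
vector of `κ`. The operator `A(y)` is coercive with constant `amin`, hence invertible with inverse
of norm at most `1 / amin`, and it is affine along each coordinate line with slope `Pⱼ`, the
compressed multiplication by `ψⱼ`.

Differentiating `A(y) g = f` gives `A ∂^ν g = -∑ⱼ νⱼ Pⱼ ∂^(ν - eⱼ) g` for `ν ≠ 0`. `derivFamily`
solves this recursion, `isMixedDerivatives_derivFamily` shows that its members are the derivatives,
and `norm_derivFamily_le` bounds them by induction on `|ν|`. Only one coordinate moves at a time, so
no topology on the infinite parameter box is needed. Both claims are instances of
`variational_wellposed_and_regular`: `V = ⊤`, and `V` finite-dimensional. -/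

namespace ParamPDE

/-! ### Multi-indices and the weights `|ν|! b^ν` -/

lemma sub_single_add_single {ι : Type*} {ν : ι →₀ ℕ} {j : ι} (hj : j ∈ ν.support) :
    ν - Finsupp.single j 1 + Finsupp.single j 1 = ν :=
  tsub_add_cancel_of_le (by
    simpa [Finsupp.single_le_iff] using Nat.one_le_iff_ne_zero.mpr (Finsupp.mem_support_iff.mp hj))

lemma degree_sub_single_add_one {ι : Type*} {ν : ι →₀ ℕ} {j : ι} (hj : j ∈ ν.support) :
    (ν - Finsupp.single j 1).degree + 1 = ν.degree := by
  simpa using congrArg Finsupp.degree (sub_single_add_single hj)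

lemma update_mem_paramBox {ι : Type*} [DecidableEq ι] {y : ι → ℝ} (hy : y ∈ paramBox ι)
    (j : ι) {t : ℝ} (ht : t ∈ Set.Icc (-1 / 2 : ℝ) (1 / 2)) : Function.update y j t ∈ paramBox ι := by
  intro i
  by_cases h : i = j
  · subst h; simpa using ht
  · simpa [h] using hy i

lemma factorialPow_zero {ι : Type*} (b : ι → ℝ) : factorialPow b 0 = 1 := by
  simp [factorialPow]

/-- Every summand is `νⱼ (|ν| - 1)! b^ν`, and the `νⱼ` add up to `|ν|`. This identity closes the
induction for the derivative bound without any loss. -/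
lemma sum_mul_factorialPow_sub_single {ι : Type*} (b : ι → ℝ) {ν : ι →₀ ℕ} (hν : ν ≠ 0) :
    ∑ j ∈ ν.support, (ν j : ℝ) * (b j * factorialPow b (ν - Finsupp.single j 1)) =
      factorialPow b ν := by
  classical
  have hd : ν.degree ≠ 0 := by simpa [Finsupp.degree_eq_zero_iff] using hν
  have key : ∀ j ∈ ν.support, (ν j : ℝ) * (b j * factorialPow b (ν - Finsupp.single j 1)) =
      (ν j : ℝ) * (((ν.degree - 1).factorial : ℝ) * ν.prod fun j n => b j ^ n) := by
    intro j hj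
    have h1 : (ν.prod fun j n => b j ^ n) =
        (ν - Finsupp.single j 1).prod (fun j n => b j ^ n) * b j := by
      conv_lhs => rw [← sub_single_add_single hj]
      rw [Finsupp.prod_add_index' (by simp) (by intros; rw [pow_add]),
        Finsupp.prod_single_index (by simp), pow_one]
    have h2 : ((ν - Finsupp.single j 1).sum fun _ n => n) = ν.degree - 1 := by
      have := degree_sub_single_add_one hj
      change (ν - Finsupp.single j 1).degree = _
      omega
    rw [factorialPow, h1, h2]
    ring
  rw [Finset.sum_congr rfl key, ← Finset.sum_mul]
  have h3 : (∑ j ∈ ν.support, (ν j : ℝ)) = ν.degree := by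
    rw [Finsupp.degree_apply]; push_cast; rfl
  rw [h3, factorialPow, ← mul_assoc]
  congr 1
  change _ = (ν.degree.factorial : ℝ)
  rw [← Nat.mul_factorial_pred hd]
  push_cast; ring

/-! ### Coercive operators affine in each parameter -/

section Abstract

variable {ι W : Type*} [DecidableEq ι] [NormedAddCommGroup W] [InnerProductSpace ℝ W]

/-- The solution `v` of the recursion `A (v ν) = δ_{ν,0} f - ∑ⱼ νⱼ Pⱼ (v (ν - eⱼ))`, where `S` is
the inverse of `A`. If `A` depends affinely on parameters, with slopes `Pⱼ`, this is the family of
mixed parameter derivatives of `A⁻¹ f`. -/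
noncomputable def derivFamily (S : W →L[ℝ] W) (P : ι → W →L[ℝ] W) (f : W) (ν : ι →₀ ℕ) : W :=
  S ((if ν = 0 then f else 0) - ∑ j ∈ ν.support.attach,
    (ν j : ℝ) • P j (derivFamily S P f (ν - Finsupp.single j.1 1)))
termination_by ν.degree
decreasing_by
  have := degree_sub_single_add_one j.2
  omega

lemma derivFamily_eq (S : W →L[ℝ] W) (P : ι → W →L[ℝ] W) (f : W) (ν : ι →₀ ℕ) :
    derivFamily S P f ν = S ((if ν = 0 then f else 0) -
      ν.sum fun j n => (n : ℝ) • P j (derivFamily S P f (ν - Finsupp.single j 1))) := by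
  rw [derivFamily, Finsupp.sum, ← Finset.sum_attach ν.support]

lemma derivFamily_zero (S : W →L[ℝ] W) (P : ι → W →L[ℝ] W) (f : W) :
    derivFamily S P f 0 = S f := by
  rw [derivFamily_eq]; simp

/-- Splits off one copy of the `j`-term, so that the recursion at `ν + eⱼ` has the shape that the
product rule yields at `ν`. -/
lemma derivFamily_add_single (S : W →L[ℝ] W) (P : ι → W →L[ℝ] W) (f : W) (ν : ι →₀ ℕ) (j : ι) :
    derivFamily S P f (ν + Finsupp.single j 1) = -S (P j (derivFamily S P f ν) +
      ν.sum fun i n => (n : ℝ) • P i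
        (derivFamily S P f (ν - Finsupp.single i 1 + Finsupp.single j 1))) := by
  classical
  have hne : ν + Finsupp.single j 1 ≠ 0 := fun h => by
    simpa using congrArg (fun μ => μ j) h
  rw [derivFamily_eq, if_neg hne, zero_sub, map_neg, Finsupp.sum_add_index' (by simp)
    (by intros; simp [add_smul]), Finsupp.sum_single_index (by simp)]
  congr 2
  rw [add_comm]
  congr 1
  · simp
  · refine Finset.sum_congr rfl fun i hi => ?_
    have : ν + Finsupp.single j 1 - Finsupp.single i 1 =
        ν - Finsupp.single i 1 + Finsupp.single j 1 := by
      conv_lhs => rw [← sub_single_add_single hi]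
      rw [add_right_comm, add_tsub_cancel_right]
    simp only [this]

lemma apply_inverse {W : Type*} [NormedAddCommGroup W] [InnerProductSpace ℝ W] {A : W →L[ℝ] W}
    (hA : IsUnit A) (w : W) : A (Ring.inverse A w) = w :=
  congrArg (fun T : W →L[ℝ] W => T w) (Ring.mul_inverse_cancel A hA)

lemma inverse_apply {W : Type*} [NormedAddCommGroup W] [InnerProductSpace ℝ W] {A : W →L[ℝ] W}
    (hA : IsUnit A) (w : W) : Ring.inverse A (A w) = w :=
  congrArg (fun T : W →L[ℝ] W => T w) (Ring.inverse_mul_cancel A hA)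

variable [CompleteSpace W]

/-- Lax-Milgram for the bilinear form `⟨A w, z⟩`. -/
lemma isUnit_of_coercive {A : W →L[ℝ] W} {α : ℝ} (hα : 0 < α)
    (hA : ∀ w, α * ‖w‖ ^ 2 ≤ inner ℝ (A w) w) : IsUnit A := by
  have hc : IsCoercive ((innerSL ℝ).comp A) :=
    ⟨α, hα, fun w => by simpa [sq, mul_assoc] using hA w⟩
  have h : (hc.continuousLinearEquivOfBilin : W →L[ℝ] W) = A := by
    ext w
    exact (hc.unique_continuousLinearEquivOfBilin (v := w) (f := A w) fun z => by simp).symm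
  rw [← h]
  exact ⟨ContinuousLinearEquiv.toUnit hc.continuousLinearEquivOfBilin, rfl⟩

lemma norm_inverse_apply_le {A : W →L[ℝ] W} {α : ℝ} (hα : 0 < α)
    (hA : ∀ w, α * ‖w‖ ^ 2 ≤ inner ℝ (A w) w) (g : W) : ‖Ring.inverse A g‖ ≤ ‖g‖ / α := by
  set w := Ring.inverse A g with hw
  have h1 : α * ‖w‖ ^ 2 ≤ ‖g‖ * ‖w‖ := by
    refine (hA w).trans ?_
    rw [hw, apply_inverse (isUnit_of_coercive hα hA)]
    exact real_inner_le_norm _ _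
  rw [le_div_iff₀ hα]
  rcases (norm_nonneg w).eq_or_lt with h0 | h0
  · rw [← h0]; simp
  · refine le_of_mul_le_mul_right ?_ h0
    nlinarith

lemma norm_derivFamily_le {A : W →L[ℝ] W} {α : ℝ} (hα : 0 < α)
    (hA : ∀ w, α * ‖w‖ ^ 2 ≤ inner ℝ (A w) w) {P : ι → W →L[ℝ] W} {β : ι → ℝ}
    (hP : ∀ j, ‖P j‖ ≤ β j) (f : W) (ν : ι →₀ ℕ) :
    ‖derivFamily (Ring.inverse A) P f ν‖ ≤
      factorialPow (fun j => β j / α) ν * (‖f‖ / α) := by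
  induction hn : ν.degree using Nat.strong_induction_on generalizing ν with
  | _ n ih =>
  by_cases hν : ν = 0
  · subst hν
    rw [derivFamily_zero, factorialPow_zero, one_mul]
    exact norm_inverse_apply_le hα hA f
  · rw [derivFamily_eq, if_neg hν, zero_sub]
    refine (norm_inverse_apply_le hα hA _).trans ?_
    rw [norm_neg, ← sum_mul_factorialPow_sub_single _ hν, div_le_iff₀ hα, Finset.sum_mul,
      Finset.sum_mul]
    refine (norm_sum_le _ _).trans (Finset.sum_le_sum fun j hj => ?_)
    rw [norm_smul, Real.norm_natCast]
    have h1 := ih _ (by have := degree_sub_single_add_one hj; omega)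
      (ν - Finsupp.single j 1) rfl
    have h2 := ((P j).le_opNorm (derivFamily (Ring.inverse A) P f (ν - Finsupp.single j 1))).trans
      (mul_le_mul (hP j) h1 (norm_nonneg _) ((norm_nonneg _).trans (hP j)))
    calc _ ≤ _ := mul_le_mul_of_nonneg_left h2 (Nat.cast_nonneg _)
      _ = _ := by field_simp

lemma hasDerivWithinAt_inverse {A : (ι → ℝ) → W →L[ℝ] W} {P : ι → W →L[ℝ] W}
    (haff : ∀ y ∈ paramBox ι, ∀ j, ∀ t ∈ Set.Icc (-1 / 2 : ℝ) (1 / 2),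
      A (Function.update y j t) = A y + (t - y j) • P j)
    {y : ι → ℝ} (hy : y ∈ paramBox ι) (hu : IsUnit (A y)) (j : ι) :
    HasDerivWithinAt (fun t => Ring.inverse (A (Function.update y j t)))
      (-(Ring.inverse (A y) * P j * Ring.inverse (A y))) (Set.Icc (-1 / 2 : ℝ) (1 / 2)) (y j) := by
  obtain ⟨x, hx⟩ := hu
  have h1 : HasDerivAt (fun t : ℝ => A y + (t - y j) • P j) (P j) (y j) := by
    simpa using (((hasDerivAt_id (y j)).sub_const (y j)).smul_const (P j)).const_add (A y)
  have h2 := hasFDerivAt_ringInverse (𝕜 := ℝ) x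
  have h3 : HasDerivAt (fun t : ℝ => Ring.inverse (A y + (t - y j) • P j))
      (-(Ring.inverse (A y) * P j * Ring.inverse (A y))) (y j) := by
    have h2' : HasFDerivAt Ring.inverse (-ContinuousLinearMap.mulLeftRight ℝ (W →L[ℝ] W)
        ↑x⁻¹ ↑x⁻¹) (A y + (y j - y j) • P j) := by simpa [← hx] using h2
    have := h2'.comp_hasDerivAt (y j) h1
    simpa [← hx, Ring.inverse_unit, Function.comp_def] using this
  -- `A` is affine only for `t` in the interval, so the full affine line is differentiated and then
  -- restricted.
  refine h3.hasDerivWithinAt.congr (fun t ht => ?_) ?_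
  · rw [haff y hy j t ht]
  · simp

lemma isMixedDerivatives_derivFamily {A : (ι → ℝ) → W →L[ℝ] W}
    {P : ι → W →L[ℝ] W}
    (haff : ∀ y ∈ paramBox ι, ∀ j, ∀ t ∈ Set.Icc (-1 / 2 : ℝ) (1 / 2),
      A (Function.update y j t) = A y + (t - y j) • P j)
    (hu : ∀ y ∈ paramBox ι, IsUnit (A y)) (f : W) :
    IsMixedDerivatives (fun y => Ring.inverse (A y) f)
      (fun ν y => derivFamily (Ring.inverse (A y)) P f ν) := by
  refine ⟨fun y _ => derivFamily_zero _ _ _, fun ν j y hy => ?_⟩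
  induction hn : ν.degree using Nat.strong_induction_on generalizing ν with
  | _ n ih =>
  have hS := hasDerivWithinAt_inverse haff hy (hu y hy) j
  have hg : HasDerivWithinAt (fun t => (if ν = 0 then f else 0) - ν.sum fun i n => (n : ℝ) • P i
      (derivFamily (Ring.inverse (A (Function.update y j t))) P f (ν - Finsupp.single i 1)))
      (-ν.sum fun i n => (n : ℝ) • P i
        (derivFamily (Ring.inverse (A y)) P f (ν - Finsupp.single i 1 + Finsupp.single j 1)))
      (Set.Icc (-1 / 2 : ℝ) (1 / 2)) (y j) := by
    refine HasDerivWithinAt.const_sub _ (HasDerivWithinAt.fun_sum fun i hi => ?_)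
    have h1 := ih _ (by have := degree_sub_single_add_one hi; omega)
      (ν - Finsupp.single i 1) rfl
    exact ((P i).hasFDerivAt.comp_hasDerivWithinAt (y j) h1).const_smul _
  -- Product rule for `S(y) g(y)`: `g` involves only lower orders, whose derivatives come from the
  -- induction hypothesis.
  have h := hS.clm_apply hg
  simp only [← derivFamily_eq] at h
  refine h.congr_deriv ?_
  beta_reduce
  rw [derivFamily_add_single]
  simp only [Function.update_eq_self, neg_apply, map_neg, map_add, neg_add,
    mul_apply_eq_comp]
  rw [← derivFamily_eq]

end Abstract

/-! ### Uniqueness and transport of mixed derivatives -/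

lemma multiIndex_induction {ι : Type*} {p : (ι →₀ ℕ) → Prop} (h0 : p 0)
    (h1 : ∀ ν j, p ν → p (ν + Finsupp.single j 1)) (ν : ι →₀ ℕ) : p ν := by
  induction hn : ν.degree generalizing ν with
  | zero => rwa [show ν = 0 from Finsupp.degree_eq_zero_iff ν |>.mp hn]
  | succ n ih =>
    obtain ⟨j, hj⟩ : ν.support.Nonempty := by
      rw [Finsupp.support_nonempty_iff]; rintro rfl; simp at hn
    rw [← sub_single_add_single hj]
    exact h1 _ _ (ih _ (by have := degree_sub_single_add_one hj; omega))

/-- Derivatives within a nondegenerate interval are unique, endpoints included. Bounds for one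
explicit family thus hold for every family. -/
lemma IsMixedDerivatives.eq_of_mem_paramBox {ι X : Type*} [DecidableEq ι] [NormedAddCommGroup X]
    [NormedSpace ℝ X] {u : (ι → ℝ) → X} {v v' : (ι →₀ ℕ) → (ι → ℝ) → X}
    (hv : IsMixedDerivatives u v) (hv' : IsMixedDerivatives u v') (ν : ι →₀ ℕ) :
    ∀ y ∈ paramBox ι, v ν y = v' ν y := by
  induction ν using multiIndex_induction with
  | h0 => exact fun y hy => (hv.1 y hy).trans (hv'.1 y hy).symm
  | h1 ν j ih =>
    intro y hy
    refine (uniqueDiffOn_Icc (by norm_num) (y j) (hy j)).eq_deriv _ (hv.2 ν j y hy) ?_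
    refine (hv'.2 ν j y hy).congr (fun t ht => ih _ (update_mem_paramBox hy j ht)) ?_
    simpa using ih y hy

lemma IsMixedDerivatives.clm_comp {ι X Y : Type*} [DecidableEq ι] [NormedAddCommGroup X]
    [NormedSpace ℝ X] [NormedAddCommGroup Y] [NormedSpace ℝ Y] {u : (ι → ℝ) → X}
    {v : (ι →₀ ℕ) → (ι → ℝ) → X} (hv : IsMixedDerivatives u v) (T : X →L[ℝ] Y) :
    IsMixedDerivatives (fun y => T (u y)) (fun ν y => T (v ν y)) :=
  ⟨fun y hy => congrArg T (hv.1 y hy), fun ν j y hy =>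
    T.hasFDerivAt.comp_hasDerivWithinAt (y j) (hv.2 ν j y hy)⟩

lemma IsMixedDerivatives.congr_left {ι X : Type*} [DecidableEq ι] [NormedAddCommGroup X]
    [NormedSpace ℝ X] {u u' : (ι → ℝ) → X} {v : (ι →₀ ℕ) → (ι → ℝ) → X}
    (hv : IsMixedDerivatives u v) (h : ∀ y ∈ paramBox ι, u y = u' y) :
    IsMixedDerivatives u' v :=
  ⟨fun y hy => (hv.1 y hy).trans (h y hy), hv.2⟩

section Poincare

variable {d : ℕ}

lemma norm_gradient (φ : E d → ℝ) (x : E d) : ‖gradient φ x‖ = ‖fderiv ℝ φ x‖ := by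
  rw [gradient, LinearIsometryEquiv.norm_map]

/-- The Poincaré inequality for compactly supported smooth functions on a bounded set. -/
lemma integral_sq_le_integral_fderiv_sq (hd : 1 ≤ d) {φ : E d → ℝ} (hφ : ContDiff ℝ ∞ φ)
    (hc : HasCompactSupport φ) {R : ℝ} (hR : ∀ x ∈ tsupport φ, ‖x‖ ≤ R) :
    ∫ x, φ x ^ 2 ≤ 4 * R ^ 2 * ∫ x, ‖fderiv ℝ φ x‖ ^ 2 := by
  let i : Fin d := ⟨0, hd⟩
  let e : E d := EuclideanSpace.single i 1
  have he : ‖e‖ = 1 := by simp [e]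
  have hdiff : Differentiable ℝ φ := hφ.differentiable (by simp)
  have hφ' : Continuous (fderiv ℝ φ) := hφ.continuous_fderiv (by simp)
  have hcont := hφ.continuous
  let π : E d →L[ℝ] ℝ := EuclideanSpace.proj i
  have hπe : π e = 1 := by simp [π, e]
  have hπ : ∀ x, |π x| ≤ ‖x‖ := fun x => by
    simpa [π] using PiLp.norm_apply_le x i
  have hsq : ∀ x, fderiv ℝ (fun z => φ z ^ 2) x e = 2 * (φ x * fderiv ℝ φ x e) := by
    intro x
    have := ((hdiff x).hasFDerivAt.pow 2).fderiv
    rw [this]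
    simp; ring
  have hc2 : HasCompactSupport (fun x => φ x ^ 2) := by
    simp only [sq]
    exact hc.mul_left (f := φ)
  have hi0 : Integrable (fun x => φ x ^ 2) := (hcont.pow 2).integrable_of_hasCompactSupport hc2
  have hi1 : Integrable (fun x => ‖fderiv ℝ φ x‖ ^ 2) := by
    refine (hφ'.norm.pow 2).integrable_of_hasCompactSupport ?_
    simp only [sq]
    exact (hc.fderiv ℝ).norm.mul_left (f := fun x => ‖fderiv ℝ φ x‖)
  have hi2 : Integrable (fun x => π x * (2 * (φ x * fderiv ℝ φ x e))) := by
    refine Continuous.integrable_of_hasCompactSupport (by fun_prop) ?_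
    exact ((hc.mul_right (f' := fun x => fderiv ℝ φ x e)).mul_left
      (f := fun _ => (2 : ℝ))).mul_left (f := fun x => π x)
  have hi3 : Integrable (fun x => π x * φ x ^ 2) := by
    refine Continuous.integrable_of_hasCompactSupport (by fun_prop) ?_
    exact hc2.mul_left (f := fun x => π x)
  -- Integration by parts of `φ²` against a coordinate function, whose derivative along `e` is `1`.
  have hibp : ∫ x, π x * (2 * (φ x * fderiv ℝ φ x e)) = -∫ x, φ x ^ 2 := by
    have := integral_mul_fderiv_eq_neg_fderiv_mul_of_integrable (μ := (volume : Measure (E d)))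
      (f := fun x => π x) (g := fun x => φ x ^ 2) (v := e)
      (by simpa [hπe] using hi0) (by simpa only [hsq] using hi2) hi3
      (fun x _ => π.differentiableAt) (fun x _ => (hdiff x).pow 2)
    simpa only [hsq, ContinuousLinearMap.fderiv, hπe, one_mul] using this
  -- Young's inequality, weighted so that half of `∫ φ²` can be absorbed on the left; this produces
  -- the constant `4 R²`.
  have hpt : ∀ x, -(π x * (2 * (φ x * fderiv ℝ φ x e))) ≤
      1 / 2 * φ x ^ 2 + 2 * R ^ 2 * ‖fderiv ℝ φ x‖ ^ 2 := by
    intro x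
    by_cases hx : x ∈ tsupport φ
    · have h1 : |fderiv ℝ φ x e| ≤ ‖fderiv ℝ φ x‖ := by
        simpa [he] using (fderiv ℝ φ x).le_opNorm e
      have h2 : |π x| ≤ R := (hπ x).trans (hR x hx)
      have h3 : |π x * fderiv ℝ φ x e| ≤ R * ‖fderiv ℝ φ x‖ := by
        rw [abs_mul]
        exact mul_le_mul h2 h1 (abs_nonneg _) ((abs_nonneg _).trans h2)
      have h4 : (π x * fderiv ℝ φ x e) ^ 2 ≤ (R * ‖fderiv ℝ φ x‖) ^ 2 := by
        rw [← sq_abs]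
        exact pow_le_pow_left₀ (abs_nonneg _) h3 2
      nlinarith [sq_nonneg (φ x + 2 * (π x * fderiv ℝ φ x e))]
    · rw [image_eq_zero_of_notMem_tsupport hx]
      simp only [zero_mul, mul_zero, neg_zero]
      positivity
  have hmono := integral_mono hi2.neg ((hi0.const_mul (1 / 2)).add (hi1.const_mul (2 * R ^ 2))) hpt
  simp only [Pi.neg_apply, Pi.add_apply] at hmono
  rw [integral_neg, hibp, neg_neg, integral_add (hi0.const_mul _) (hi1.const_mul _),
    integral_const_mul, integral_const_mul] at hmono
  linarith

lemma Lp_norm_sq_eq_integral {α F : Type*} [MeasurableSpace α] {μ : Measure α}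
    [NormedAddCommGroup F] [InnerProductSpace ℝ F] (g : Lp F 2 μ) :
    ‖g‖ ^ 2 = ∫ x, ‖g x‖ ^ 2 ∂μ := by
  rw [← real_inner_self_eq_norm_sq, L2.inner_def]
  simp only [real_inner_self_eq_norm_sq]

lemma setIntegral_eq_integral_of_tsupport_subset {D : Set (E d)} {g : E d → ℝ}
    (hg : tsupport g ⊆ D) : ∫ x in D, g x = ∫ x, g x :=
  setIntegral_eq_integral_of_forall_compl_eq_zero fun _ hx =>
    image_eq_zero_of_notMem_tsupport fun h => hx (hg h)

lemma norm_fst_le_of_mem_testPairs (hd : 1 ≤ d) {D : Set (E d)} {R : ℝ} (hR0 : 0 ≤ R)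
    (hR : ∀ x ∈ D, ‖x‖ ≤ R) {p : L2Pair D} (hp : p ∈ testPairs D) :
    ‖p.fst‖ ≤ 2 * R * ‖p.snd‖ := by
  obtain ⟨φ, h1, h2, h3, h4, h5⟩ := hp
  have k1 : ‖p.fst‖ ^ 2 = ∫ x, φ x ^ 2 := by
    rw [Lp_norm_sq_eq_integral, ← setIntegral_eq_integral_of_tsupport_subset (D := D)]
    · refine integral_congr_ae (h4.mono fun x hx => ?_)
      simp [hx]
    · exact (closure_mono fun x hx => by simpa using hx).trans h3
  have k2 : ‖p.snd‖ ^ 2 = ∫ x, ‖fderiv ℝ φ x‖ ^ 2 := by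
    rw [Lp_norm_sq_eq_integral, ← setIntegral_eq_integral_of_tsupport_subset (D := D)]
    · refine integral_congr_ae (h5.mono fun x hx => ?_)
      simp only [hx, norm_gradient]
    · refine (closure_mono (t := tsupport (fderiv ℝ φ)) fun x hx => ?_).trans ?_
      · exact subset_tsupport _ (by simpa using hx)
      · exact (closure_minimal subset_rfl (isClosed_tsupport _)).trans
          ((tsupport_fderiv_subset ℝ).trans h3)
  refine le_of_sq_le_sq ?_ (by positivity)
  rw [mul_pow, k1, k2]
  refine (integral_sq_le_integral_fderiv_sq hd h1 h2 fun x hx => hR x (h3 hx)).trans_eq ?_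
  ring

/-- The Poincaré inequality on `H¹₀(D)`, for bounded `D`. -/
lemma exists_norm_le_mul_norm_grad (hd : 1 ≤ d) {D : Set (E d)} (hDb : Bornology.IsBounded D) :
    ∃ C : ℝ, ∀ w : H10 D, ‖w‖ ≤ C * ‖grad w‖ := by
  obtain ⟨R', hR'⟩ := hDb.exists_norm_le
  set R := max R' 0
  have hR : ∀ x ∈ D, ‖x‖ ≤ R := fun x hx => (hR' x hx).trans (le_max_left _ _)
  have hR0 : 0 ≤ R := le_max_right _ _
  have hcl : IsClosed {p : L2Pair D | ‖p.fst‖ ≤ 2 * R * ‖p.snd‖} :=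
    isClosed_le (WithLp.fstL 2 ℝ _ _).continuous.norm
      (continuous_const.mul (WithLp.sndL 2 ℝ _ _).continuous.norm)
  -- The full norm includes the gradient, and `(2R)² + 1 ≤ (2R + 1)²`.
  refine ⟨2 * R + 1, fun w => ?_⟩
  have hw : ‖(w : L2Pair D).fst‖ ≤ 2 * R * ‖(w : L2Pair D).snd‖ :=
    closure_minimal (fun p hp => norm_fst_le_of_mem_testPairs hd hR0 hR hp) hcl w.2
  refine le_of_sq_le_sq ?_ (mul_nonneg (by positivity) (norm_nonneg _))
  rw [Submodule.coe_norm, WithLp.prod_norm_sq_eq_of_L2]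
  change _ ≤ ((2 * R + 1) * ‖(w : L2Pair D).snd‖) ^ 2
  have := pow_le_pow_left₀ (norm_nonneg _) hw 2
  nlinarith [sq_nonneg ‖(w : L2Pair D).snd‖, mul_nonneg hR0 (sq_nonneg ‖(w : L2Pair D).snd‖)]

end Poincare

/-! ### Multiplication operators on `L₂` -/

section Multiplication

variable {α F : Type*} [MeasurableSpace α] {μ : Measure α} [NormedAddCommGroup F]
  [InnerProductSpace ℝ F]

/-- Multiplication of `L₂` functions by `L_∞` functions. -/
noncomputable def mulL : Lp ℝ ⊤ μ →L[ℝ] Lp F 2 μ →L[ℝ] Lp F 2 μ :=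
  (ContinuousLinearMap.lsmul ℝ ℝ : ℝ →L[ℝ] F →L[ℝ] F).holderL μ ⊤ 2 2

lemma norm_mulL_le (a : Lp ℝ ⊤ μ) : ‖(mulL a : Lp F 2 μ →L[ℝ] Lp F 2 μ)‖ ≤ ‖a‖ := by
  refine ContinuousLinearMap.opNorm_le_bound _ (norm_nonneg _) fun g => ?_
  refine ((ContinuousLinearMap.lsmul ℝ ℝ : ℝ →L[ℝ] F →L[ℝ] F).norm_holder_apply_apply_le
    (r := 2) a g).trans ?_
  have h : ‖(ContinuousLinearMap.lsmul ℝ ℝ : ℝ →L[ℝ] F →L[ℝ] F)‖ ≤ 1 :=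
    ContinuousLinearMap.opNorm_lsmul_le
  have := mul_nonneg (norm_nonneg a) (norm_nonneg g)
  rw [mul_assoc]
  nlinarith

lemma coeFn_mulL (a : Lp ℝ ⊤ μ) (g : Lp F 2 μ) : mulL a g =ᵐ[μ] fun x => a x • g x :=
  (ContinuousLinearMap.lsmul ℝ ℝ : ℝ →L[ℝ] F →L[ℝ] F).coeFn_holder a g

lemma inner_mulL {a : Lp ℝ ⊤ μ} {c : α → ℝ} (hac : a =ᵐ[μ] c) (g h : Lp F 2 μ) :
    inner ℝ (mulL a g) h = ∫ x, c x * inner ℝ (g x) (h x) ∂μ := by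
  rw [L2.inner_def]
  refine integral_congr_ae ?_
  filter_upwards [coeFn_mulL a g, hac] with x hx hx'
  rw [hx, hx', real_inner_smul_left]

lemma mul_norm_sq_le_inner_mulL {a : Lp ℝ ⊤ μ} {m : ℝ} (ham : ∀ᵐ x ∂μ, m ≤ a x) (g : Lp F 2 μ) :
    m * ‖g‖ ^ 2 ≤ inner ℝ (mulL a g) g := by
  rw [Lp_norm_sq_eq_integral, ← integral_const_mul, L2.inner_def]
  have hi : Integrable (fun x => ‖g x‖ ^ 2) μ := by
    simpa only [real_inner_self_eq_norm_sq] using L2.integrable_inner (𝕜 := ℝ) g g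
  refine integral_mono_ae (hi.const_mul m) (L2.integrable_inner _ _) ?_
  filter_upwards [coeFn_mulL a g, ham] with x hx hx'
  rw [hx, real_inner_smul_left, real_inner_self_eq_norm_sq]
  exact mul_le_mul_of_nonneg_right hx' (by positivity)

lemma mulL_eq_add_smul_of_ae_eq {a a' b : Lp ℝ ⊤ μ} {r : ℝ}
    (h : a' =ᵐ[μ] fun x => a x + r * b x) :
    (mulL a' : Lp F 2 μ →L[ℝ] Lp F 2 μ) = mulL a + r • mulL b := by
  have : a' = a + r • b := by
    refine Lp.ext ?_
    filter_upwards [h, Lp.coeFn_add a (r • b), Lp.coeFn_smul r b] with x h1 h2 h3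
    rw [h1, h2, Pi.add_apply, h3, Pi.smul_apply, smul_eq_mul]
  rw [this, map_add, map_smul]

end Multiplication

/-! ### Compression to a subspace -/

section Compression

variable {H : Type*} [NormedAddCommGroup H] [InnerProductSpace ℝ H] (W : Submodule ℝ H)
  [W.HasOrthogonalProjection]

/-- The compression of an operator to a subspace. -/
noncomputable def compression (T : H →L[ℝ] H) : W →L[ℝ] W :=
  W.orthogonalProjectionOnto ∘L T ∘L W.subtypeL

lemma inner_compression (T : H →L[ℝ] H) (w z : W) :
    inner ℝ (compression W T w) z = inner ℝ (T w) (z : H) :=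
  W.inner_orthogonalProjectionOnto_eq_of_mem_right z (T w)

lemma norm_compression_le (T : H →L[ℝ] H) : ‖compression W T‖ ≤ ‖T‖ := by
  refine ContinuousLinearMap.opNorm_le_bound _ (norm_nonneg _) fun w => ?_
  have h := W.orthogonalProjectionOnto.le_opNorm (T w)
  have h1 := W.orthogonalProjectionOnto_norm_le
  have h2 := T.le_opNorm (w : H)
  calc ‖compression W T w‖ ≤ ‖W.orthogonalProjectionOnto‖ * ‖T w‖ := h
    _ ≤ 1 * ‖T w‖ := by gcongr
    _ ≤ ‖T‖ * ‖w‖ := by simpa using h2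

lemma compression_add (S T : H →L[ℝ] H) :
    compression W (S + T) = compression W S + compression W T := by
  ext w; simp [compression]

lemma compression_smul (c : ℝ) (T : H →L[ℝ] H) :
    compression W (c • T) = c • compression W T := by
  ext w; simp [compression]

end Compression

/-! ### Parametric Lax-Milgram -/

section Galerkin

/-- Parametric Lax-Milgram: a variational problem whose operator is affine in each parameter has a
unique solution, with mixed parameter derivatives of all orders and factorial bounds on them. -/
theorem exists_mixedDerivatives_of_coercive {ι X H : Type*} [DecidableEq ι]
    [NormedAddCommGroup X] [NormedSpace ℝ X] [CompleteSpace X]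
    [NormedAddCommGroup H] [InnerProductSpace ℝ H] [CompleteSpace H]
    (G : X →L[ℝ] H) {C : ℝ} (hC : ∀ w, ‖w‖ ≤ C * ‖G w‖)
    (κ : X →L[ℝ] ℝ) {K : ℝ} (hK : 0 ≤ K) (hκ : ∀ w, |κ w| ≤ K * ‖G w‖)
    {M : (ι → ℝ) → H →L[ℝ] H} {N : ι → H →L[ℝ] H} {α : ℝ} (hα : 0 < α) {β : ι → ℝ}
    (hM : ∀ y ∈ paramBox ι, ∀ g, α * ‖g‖ ^ 2 ≤ inner ℝ (M y g) g)
    (hN : ∀ j, ‖N j‖ ≤ β j)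
    (haff : ∀ y ∈ paramBox ι, ∀ j, ∀ t ∈ Set.Icc (-1 / 2 : ℝ) (1 / 2),
      M (Function.update y j t) = M y + (t - y j) • N j) :
    ∃ v : (ι →₀ ℕ) → (ι → ℝ) → X, IsMixedDerivatives (v 0) v ∧
      (∀ y ∈ paramBox ι, ∀ u,
        (∀ z, inner ℝ (M y (G u)) (G z) = κ z) ↔ u = v 0 y) ∧
      ∀ ν, ∀ y ∈ paramBox ι, ‖G (v ν y)‖ ≤ factorialPow (fun j => β j / α) ν * (K / α) := by
  -- The lower bound on `G` makes it injective with closed range, so `W` is a Hilbert space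
  -- isomorphic to `X`.
  have hanti : AntilipschitzWith C.toNNReal G := by
    refine G.antilipschitz_of_bound fun w => (hC w).trans ?_
    exact mul_le_mul_of_nonneg_right (Real.le_coe_toNNReal C) (norm_nonneg _)
  have hcl : IsClosed (Set.range G) := hanti.isClosed_range G.uniformContinuous
  let W := G.range
  have : CompleteSpace W := hcl.completeSpace_coe
  obtain ⟨e, he⟩ : ∃ e : X ≃L[ℝ] W, ∀ w, (e w : H) = G w :=
    ⟨G.equivRange hanti.injective hcl, fun _ => rfl⟩
  have hes : ∀ g : W, G (e.symm g) = g := fun g => by rw [← he, e.apply_symm_apply]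
  let A : (ι → ℝ) → W →L[ℝ] W := fun y => compression W (M y)
  let P : ι → W →L[ℝ] W := fun j => compression W (N j)
  have hcoer : ∀ y ∈ paramBox ι, ∀ w : W, α * ‖w‖ ^ 2 ≤ inner ℝ (A y w) w := fun y hy w => by
    rw [inner_compression]
    exact hM y hy w
  have hunit : ∀ y ∈ paramBox ι, IsUnit (A y) := fun y hy => isUnit_of_coercive hα (hcoer y hy)
  have hAaff : ∀ y ∈ paramBox ι, ∀ j, ∀ t ∈ Set.Icc (-1 / 2 : ℝ) (1 / 2),
      A (Function.update y j t) = A y + (t - y j) • P j := fun y hy j t ht => by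
    simp only [A, P, haff y hy j t ht, compression_add, compression_smul]
  have hP : ∀ j, ‖P j‖ ≤ β j := fun j => (norm_compression_le W _).trans (hN j)
  obtain ⟨f, hf, hfn⟩ : ∃ f : W, (∀ w, inner ℝ f (e w) = κ w) ∧ ‖f‖ ≤ K := by
    refine ⟨(InnerProductSpace.toDual ℝ W).symm (κ ∘L (e.symm : W →L[ℝ] X)), fun w => ?_, ?_⟩
    · simp
    · rw [LinearIsometryEquiv.norm_map]
      refine ContinuousLinearMap.opNorm_le_bound _ hK fun g => ?_
      have := hκ (e.symm g)
      rwa [hes] at this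
  have hmix := (isMixedDerivatives_derivFamily hAaff hunit f).clm_comp (e.symm : W →L[ℝ] X)
  refine ⟨fun ν y => e.symm (derivFamily (Ring.inverse (A y)) P f ν), ⟨fun _ _ => rfl, hmix.2⟩,
    fun y hy u => ?_, fun ν y hy => ?_⟩
  -- Every test vector in `W` is some `G z`, so the weak equation is an operator equation in `W`.
  · have key : (∀ z, inner ℝ (M y (G u)) (G z) = κ z) ↔ A y (e u) = f := by
      constructor
      · intro h
        refine ext_inner_right ℝ fun g => ?_
        obtain ⟨z, rfl⟩ := e.surjective g
        rw [inner_compression, hf, he, he, h]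
      · intro h z
        rw [← hf, ← h, inner_compression, he, he]
    beta_reduce
    rw [key, derivFamily_zero]
    constructor
    · intro h
      rw [← h, inverse_apply (hunit y hy)]
      exact (e.symm_apply_apply u).symm
    · rintro rfl
      exact (congrArg (A y) (e.apply_symm_apply _)).trans (apply_inverse (hunit y hy) f)
  · refine (congrArg norm (hes _)).trans_le ?_
    refine (norm_derivFamily_le hα (hcoer y hy) hP f ν).trans ?_
    refine mul_le_mul_of_nonneg_left (div_le_div_of_nonneg_right hfn hα.le) ?_
    exact mul_nonneg (Nat.cast_nonneg _) (Finset.prod_nonneg fun j _ =>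
      pow_nonneg (div_nonneg ((norm_nonneg _).trans (hN j)) hα.le) _)

end Galerkin

/-! ### Variational problems in `H¹₀(D)` -/

section Sobolev

variable {d : ℕ} {D : Set (E d)}

instance : CompleteSpace (H10 D) :=
  (Submodule.isClosed_topologicalClosure (testPairs D)).completeSpace_coe

/-- The weak gradient as a continuous linear map. -/
noncomputable def gradL (D : Set (E d)) : H10 D →L[ℝ] Lp (E d) 2 (volume.restrict D) :=
  WithLp.sndL 2 ℝ _ _ ∘L (H10 D).subtypeL

@[simp]
lemma gradL_apply (w : H10 D) : gradL D w = grad w := rfl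

lemma dualNorm_nonneg (κ : H10 D →L[ℝ] ℝ) : 0 ≤ dualNorm κ := by
  refine Real.sSup_nonneg ?_
  rintro r ⟨w, -, rfl⟩
  exact abs_nonneg _

/-- Scaling to `‖grad w‖ = 1`. Poincaré makes the set under `sSup` bounded, and settles the case
`grad w = 0`. -/
lemma abs_apply_le_dualNorm {C : ℝ} (hC : ∀ w : H10 D, ‖w‖ ≤ C * ‖grad w‖)
    (κ : H10 D →L[ℝ] ℝ) (w : H10 D) : |κ w| ≤ dualNorm κ * ‖grad w‖ := by
  have hb : BddAbove {r : ℝ | ∃ w : H10 D, ‖grad w‖ ≤ 1 ∧ r = |κ w|} := by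
    refine ⟨‖κ‖ * |C|, ?_⟩
    rintro r ⟨w, hw, rfl⟩
    refine (κ.le_opNorm w).trans (mul_le_mul_of_nonneg_left ?_ (norm_nonneg κ))
    refine (hC w).trans ((mul_le_mul_of_nonneg_right (le_abs_self C) (norm_nonneg _)).trans ?_)
    exact mul_le_of_le_one_right (abs_nonneg _) hw
  rcases (norm_nonneg (grad w)).eq_or_lt with h0 | h0
  · have : w = 0 := norm_le_zero_iff.mp (by simpa [← h0] using hC w)
    simp [this, mul_nonneg (dualNorm_nonneg κ)]
  · have h1 : |κ (‖grad w‖⁻¹ • w)| ≤ dualNorm κ := by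
      refine le_csSup hb ⟨_, ?_, rfl⟩
      rw [← gradL_apply, map_smul, gradL_apply, norm_smul, norm_inv, norm_norm,
        inv_mul_cancel₀ h0.ne']
    rw [map_smul, smul_eq_mul, abs_mul, abs_of_pos (inv_pos.mpr h0), inv_mul_le_iff₀ h0] at h1
    linarith

set_option maxSynthPendingDepth 5 in
/-- Well-posedness, differentiability in the parameters and derivative bounds for a variational
problem on a complete subspace of `H¹₀(D)` whose coefficient is affine in each parameter. -/
theorem variational_wellposed_and_regular (hd : 1 ≤ d) (hDb : Bornology.IsBounded D)
    {ι : Type*} [DecidableEq ι] (V : Submodule ℝ (H10 D)) [CompleteSpace V]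
    {c : (ι → ℝ) → E d → ℝ} {ψ : ι → E d → ℝ} {amin amax : ℝ} (hamin : 0 < amin)
    (hψ : ∀ j, MemLp (ψ j) ⊤ (volume.restrict D))
    (hmeas : ∀ y ∈ paramBox ι, AEStronglyMeasurable (c y) (volume.restrict D))
    (hbd : ∀ y ∈ paramBox ι, ∀ᵐ x ∂(volume.restrict D), amin ≤ c y x ∧ c y x ≤ amax)
    (haff : ∀ y ∈ paramBox ι, ∀ j, ∀ t ∈ Set.Icc (-1 / 2 : ℝ) (1 / 2),
      c (Function.update y j t) =ᵐ[volume.restrict D] fun x => c y x + (t - y j) * ψ j x)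
    (κ : H10 D →L[ℝ] ℝ) :
    (∀ y ∈ paramBox ι, ∃! u : H10 D, IsVariationalSolution V (c y) κ u) ∧
      ∀ u : (ι → ℝ) → H10 D, (∀ y ∈ paramBox ι, IsVariationalSolution V (c y) κ (u y)) →
        (∃ v, IsMixedDerivatives u v) ∧
        ∀ v, IsMixedDerivatives u v → ∀ (ν : ι →₀ ℕ), ∀ y ∈ paramBox ι,
          ‖grad (v ν y)‖ ≤ factorialPow (bSeq D ψ amin) ν * (dualNorm κ / amin) := by
  obtain ⟨C, hC⟩ := exists_norm_le_mul_norm_grad hd hDb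
  have hex : ∀ y, ∃ a : Lp ℝ ⊤ (volume.restrict D), y ∈ paramBox ι →
      a =ᵐ[volume.restrict D] c y := by
    intro y
    by_cases hy : y ∈ paramBox ι
    · have hm : MemLp (c y) ⊤ (volume.restrict D) := by
        refine memLp_top_of_bound (hmeas y hy) amax ((hbd y hy).mono fun x hx => ?_)
        rw [Real.norm_eq_abs, abs_le]
        constructor <;> linarith [hx.1, hx.2]
      exact ⟨hm.toLp, fun _ => hm.coeFn_toLp⟩
    · exact ⟨0, fun h => absurd h hy⟩
  choose a ha using hex
  have hcoer : ∀ y ∈ paramBox ι, ∀ g : Lp (E d) 2 (volume.restrict D),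
      amin * ‖g‖ ^ 2 ≤ inner ℝ (mulL (a y) g) g := by
    intro y hy g
    refine mul_norm_sq_le_inner_mulL ?_ _
    filter_upwards [ha y hy, hbd y hy] with x hx hx'
    rw [hx]; exact hx'.1
  have hMaff : ∀ y ∈ paramBox ι, ∀ j, ∀ t ∈ Set.Icc (-1 / 2 : ℝ) (1 / 2),
      (mulL (a (Function.update y j t)) : Lp (E d) 2 (volume.restrict D) →L[ℝ] _) =
        mulL (a y) + (t - y j) • mulL (hψ j).toLp := by
    intro y hy j t ht
    refine mulL_eq_add_smul_of_ae_eq ?_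
    filter_upwards [ha _ (update_mem_paramBox hy j ht), haff y hy j t ht, ha y hy,
      (hψ j).coeFn_toLp] with x h1 h2 h3 h4
    rw [h1, h2, h3, h4]
  obtain ⟨v₀, hmix, hsol, hbound⟩ := exists_mixedDerivatives_of_coercive
    (gradL D ∘L V.subtypeL) (fun w => hC w) (κ ∘L V.subtypeL) (dualNorm_nonneg κ)
    (fun w => abs_apply_le_dualNorm hC κ w) hamin hcoer
    (fun j => (norm_mulL_le _).trans_eq (Lp.norm_toLp _ (hψ j))) hMaff
  have hsol' : ∀ y ∈ paramBox ι, ∀ u,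
      IsVariationalSolution V (c y) κ u ↔ u = (v₀ 0 y : H10 D) := by
    intro y hy u
    constructor
    · rintro ⟨huV, hu⟩
      refine congrArg Subtype.val ((hsol y hy ⟨u, huV⟩).mp fun z => ?_)
      exact (inner_mulL (ha y hy) _ _).trans (hu z z.2)
    · rintro rfl
      refine ⟨(v₀ 0 y).2, fun z hz => ?_⟩
      exact (inner_mulL (ha y hy) _ _).symm.trans ((hsol y hy _).mpr rfl ⟨z, hz⟩)
  refine ⟨fun y hy => ⟨_, (hsol' y hy _).mpr rfl, fun u hu => (hsol' y hy u).mp hu⟩,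
    fun u hu => ?_⟩
  have hmix' := (hmix.clm_comp V.subtypeL).congr_left fun y hy =>
    ((hsol' y hy (u y)).mp (hu y hy)).symm
  refine ⟨⟨_, hmix'⟩, fun v hv ν y hy => ?_⟩
  rw [hv.eq_of_mem_paramBox hmix' ν y hy]
  exact hbound ν y hy

end Sobolev

/-! ### The affine coefficient and its truncation -/

section Coefficient

variable {d : ℕ} {D : Set (E d)} {a₀ : E d → ℝ} {ψ : ℕ → E d → ℝ}

lemma aestronglyMeasurable_coeff (ha₀ : MemLp a₀ ⊤ (volume.restrict D))
    (hψ : ∀ j, MemLp (ψ j) ⊤ (volume.restrict D)) {y : ℕ → ℝ}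
    (hy : ∀ᵐ x ∂(volume.restrict D), Summable (fun j => y j * ψ j x)) :
    AEStronglyMeasurable (coeff a₀ ψ y) (volume.restrict D) := by
  refine ha₀.1.add (aestronglyMeasurable_of_tendsto_ae Filter.atTop
    (f := fun n x => ∑ j ∈ Finset.range n, y j * ψ j x) (fun n => ?_) ?_)
  · exact Finset.aestronglyMeasurable_fun_sum _ fun j _ => (hψ j).1.const_mul (y j)
  · filter_upwards [hy] with x hx
    exact hx.hasSum.tendsto_sum_nat

lemma coeff_update {ι : Type*} [DecidableEq ι] {ψ : ι → E d → ℝ} {y : ι → ℝ} {x : E d}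
    (hy : Summable (fun j => y j * ψ j x)) (j : ι) (t : ℝ) :
    coeff a₀ ψ (Function.update y j t) x = coeff a₀ ψ y x + (t - y j) * ψ j x := by
  have h := hy.hasSum.update j (t * ψ j x)
  have h' : Function.update (fun j => y j * ψ j x) j (t * ψ j x) =
      fun i => Function.update y j t i * ψ i x := by
    ext i
    by_cases hi : i = j
    · subst hi; simp
    · simp [hi]
  rw [h'] at h
  rw [coeff, h.tsum_eq, coeff]
  ring

/-- Extension of finitely many parameters by zero. -/
def extendZero {s : ℕ} (y : Fin s → ℝ) (j : ℕ) : ℝ :=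
  if h : j < s then y ⟨j, h⟩ else 0

lemma extendZero_mem_paramBox {s : ℕ} {y : Fin s → ℝ} (hy : y ∈ paramBox (Fin s)) :
    extendZero y ∈ paramBox ℕ := by
  intro j
  unfold extendZero
  split_ifs with h
  · exact hy _
  · constructor <;> norm_num

/-- Truncation is the full coefficient at a point of the box with zero tail, so it inherits
measurability and the bounds `amin`, `amax`. -/
lemma coeff_extendZero {s : ℕ} (y : Fin s → ℝ) :
    coeff a₀ ψ (extendZero y) = coeff a₀ (fun j : Fin s => ψ j) y := by
  ext x
  rw [coeff, coeff, tsum_fintype (L := .unconditional (Fin s)),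
    tsum_eq_sum (s := Finset.range s), Finset.sum_range]
  · simp [extendZero]
  · intro j hj
    simp [extendZero, Finset.mem_range.not.mp hj]

end Coefficient

end ParamPDE

theorem mainTheorem1 {d : ℕ} (hd : 1 ≤ d) (D : Set (E d)) (hDo : IsOpen D)
    (hDb : Bornology.IsBounded D)
    (a₀ : E d → ℝ) (ψ : ℕ → E d → ℝ) (amin amax : ℝ) (hamin : 0 < amin)
    (ha₀ : MemLp a₀ ⊤ (volume.restrict D))
    (hψ : ∀ j, MemLp (ψ j) ⊤ (volume.restrict D))
    (ha : ∀ y ∈ paramBox ℕ, ∀ᵐ x ∂(volume.restrict D),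
      Summable (fun j => y j * ψ j x) ∧ amin ≤ coeff a₀ ψ y x ∧ coeff a₀ ψ y x ≤ amax)
    (κ : H10 D →L[ℝ] ℝ) :
    -- the true solution
    ((∀ y ∈ paramBox ℕ, ∃! u : H10 D, IsWeakSolution (coeff a₀ ψ y) κ u) ∧
      ∀ u : (ℕ → ℝ) → H10 D,
        (∀ y ∈ paramBox ℕ, IsWeakSolution (coeff a₀ ψ y) κ (u y)) →
        (∃ v, IsMixedDerivatives u v) ∧
        ∀ v, IsMixedDerivatives u v → ∀ (ν : ℕ →₀ ℕ), ∀ y ∈ paramBox ℕ,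
          ‖grad (v ν y)‖ ≤ factorialPow (bSeq D ψ amin) ν * (dualNorm κ / amin)) ∧
    -- the finite element solution in `V` of the problem truncated to `s` terms
    (∀ (s : ℕ) (V : Submodule ℝ (H10 D)), FiniteDimensional ℝ V →
      (∀ y ∈ paramBox (Fin s), ∃! u : H10 D,
        IsVariationalSolution V (coeff a₀ (fun j : Fin s => ψ j) y) κ u) ∧
      ∀ u : (Fin s → ℝ) → H10 D,
        (∀ y ∈ paramBox (Fin s),
          IsVariationalSolution V (coeff a₀ (fun j : Fin s => ψ j) y) κ (u y)) →
        (∃ v, IsMixedDerivatives u v) ∧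
        ∀ v, IsMixedDerivatives u v → ∀ (ν : Fin s →₀ ℕ), ∀ y ∈ paramBox (Fin s),
          ‖grad (v ν y)‖ ≤
            factorialPow (bSeq D (fun j : Fin s => ψ j) amin) ν * (dualNorm κ / amin)) := by
  have hmeas : ∀ y ∈ paramBox ℕ, AEStronglyMeasurable (coeff a₀ ψ y) (volume.restrict D) :=
    fun y hy => aestronglyMeasurable_coeff ha₀ hψ ((ha y hy).mono fun _ h => h.1)
  constructor
  · have : CompleteSpace (⊤ : Submodule ℝ (H10 D)) := isClosed_univ.completeSpace_coe
    exact variational_wellposed_and_regular hd hDb ⊤ hamin hψ hmeas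
      (fun y hy => (ha y hy).mono fun _ h => h.2)
      (fun y hy j t _ => (ha y hy).mono fun x h => coeff_update h.1 j t) κ
  · intro s V _
    have : CompleteSpace V := FiniteDimensional.complete ℝ V
    refine variational_wellposed_and_regular hd hDb V hamin (fun j : Fin s => hψ j) ?_
      (amax := amax) ?_ (fun y _ j t _ => Filter.Eventually.of_forall fun x =>
        coeff_update (Summable.of_finite) j t) κ
    · intro y hy
      rw [← coeff_extendZero]
      exact hmeas _ (extendZero_mem_paramBox hy)
    · intro y hy
      rw [← coeff_extendZero]
      exact (ha _ (extendZero_mem_paramBox hy)).mono fun _ h => h.2
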